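/- All graphs are finite, undirected and simple. For a graph $G$ of order $n$ let $\lambda_1(G)\ge\lambda_2(G)\ge\dots\ge\lambda_n(G)$ be the eigenvalues of its adjacency matrix, counted with multiplicity, and let $\overline{G}$ be its complement. The Lovász $\theta$-function is $$\theta(G)=\min_{u,c}\ \max_{i\in V(G)}\ \frac{1}{(c^{T}u_i)^2},$$ where the minimum is over all unit vectors $c$ and all orthonormal representations $\{u_i: i\in V(G)\}$ of $G$, i.e. assignments of unit vectors $u_i\in\mathbb{R}^m$ ($m$ arbitrary, the same for $c$ and all $u_i$) with $u_i^{T}u_j=0$ whenever $i\ne j$ are non-adjacent, and where $1/0=\infty$. Let $G$ be a $d$-regular graph of order $n$ which is neither complete nor empty (edgeless). Then: (a) $$\frac{n-d+\lambda_2(G)}{1+\lambda_2(G)}\ \le\ \theta(G)\ \le\ -\frac{n\,\lambda_n(G)}{d-\lambda_n(G)}.$$ Equality holds in the left inequality if $\overline{G}$ is both vertex-transitive and edge-transitive, or if $G$ is strongly regular. Equality holds in the right inequality if $G$ is edge-transitive, or if $G$ is strongly regular. (b) $$1-\frac{d}{\lambda_n(G)}\ \le\ \theta(\overline{G})\ \le\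 \frac{n\,(1+\lambda_2(G))}{n-d+\lambda_2(G)}.$$ Equality holds in the left inequality if $G$ is both vertex-transitive and edge-transitive, or if $G$ is strongly regular. Equality holds in the right inequality if $\overline{G}$ is edge-transitive, or if $G$ is strongly regular. Here $G$ is vertex-transitive if for every two vertices some automorphism of $G$ maps one to the other; edge-transitive if for every two edges $\{u_1,v_1\},\{u_2,v_2\}$ some automorphism $f$ of $G$ satisfies $\{f(u_1),f(v_1)\}=\{u_2,v_2\}$; and a $d$-regular $G$ is strongly regular if there are integers $\lambda,\mu\ge 0$ such that every two adjacent vertices have exactly $\lambda$ common neighbours and every two distinct non-adjacent vertices have exactly $\mu$ common neighbours. -/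

import Mathlib

/-- The `k`-th largest eigenvalue (`1 ≤ k ≤ |V|`, counted with multiplicity) of the adjacency
matrix of `G`, so that `graphEigenvalue G 1 ≥ graphEigenvalue G 2 ≥ ⋯ ≥ graphEigenvalue G |V|`.
(Outside the range `1 ≤ k ≤ |V|` the value is the dummy `0`.) -/
noncomputable def graphEigenvalue {V : Type*} [Fintype V] [DecidableEq V]
    (G : SimpleGraph V) [DecidableRel G.Adj] (k : ℕ) : ℝ :=
  if h : 1 ≤ k ∧ k ≤ Fintype.card V then
    (G.isHermitian_adjMatrix ℝ).eigenvalues₀ ⟨k - 1, by omega⟩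
  else 0

/-- An orthonormal representation of `G` in `ℝᵐ`: every vertex is assigned a unit vector, and
distinct non-adjacent vertices are assigned orthogonal vectors. -/
structure IsOrthonormalRepresentation {V : Type*} (G : SimpleGraph V) {m : ℕ}
    (u : V → EuclideanSpace ℝ (Fin m)) : Prop where
  norm_eq_one : ∀ i, ‖u i‖ = 1
  inner_eq_zero : ∀ i j, i ≠ j → ¬ G.Adj i j → inner ℝ (u i) (u j) = 0

/-- The finite values `max_i 1 / (cᵀ uᵢ)²`, over all orthonormal representations `u` of `G` in
Euclidean spaces of arbitrary finite dimension and all unit handles `c`. The condition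
`cᵀ uᵢ ≠ 0` discards the pairs `(u, c)` for which that maximum is infinite. -/
def lovaszThetaValues {V : Type*} (G : SimpleGraph V) : Set ℝ :=
  {t : ℝ | ∃ (m : ℕ) (u : V → EuclideanSpace ℝ (Fin m)) (c : EuclideanSpace ℝ (Fin m)),
    IsOrthonormalRepresentation G u ∧ ‖c‖ = 1 ∧ (∀ i, inner ℝ c (u i) ≠ 0) ∧
    t = ⨆ i, 1 / (inner ℝ c (u i)) ^ 2}

/-- The Lovász theta function of a finite simple graph: the minimum, over all orthonormal
representations `u` and unit handles `c`, of `max_i 1 / (cᵀ uᵢ)²`. -/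
noncomputable def lovaszTheta {V : Type*} [Finite V] (G : SimpleGraph V) : ℝ :=
  sInf (lovaszThetaValues G)

/-- For every two vertices there is an automorphism mapping the first to the second. -/
def IsVertexTransitive {V : Type*} (G : SimpleGraph V) : Prop :=
  ∀ v w : V, ∃ f : G ≃g G, f v = w

/-- For every two edges `{u₁, v₁}` and `{u₂, v₂}` there is an automorphism `f` with
`{u₂, v₂} = {f u₁, f v₁}`. -/
def IsEdgeTransitive {V : Type*} (G : SimpleGraph V) : Prop :=
  ∀ u₁ v₁ u₂ v₂ : V, G.Adj u₁ v₁ → G.Adj u₂ v₂ → ∃ f : G ≃g G, s(u₂, v₂) = s(f u₁, f v₁)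

/-! Everything rests on weak semidefinite duality for θ. A positive semidefinite `N` with diagonal
`t - 1` and entry `-1` at distinct non-adjacent pairs gives θ ≤ t; a positive semidefinite `B` of
positive trace vanishing on edges gives θ ≥ (sum of entries) / trace. For a `d`-regular `H` whose
least adjacency eigenvalue on the complement of the all-ones vector is `s < 0`, the matrices tI - J
+ xA and A - sI yield an upper bound for θ(H) and a lower bound for θ(Hᶜ). The choices H = G, s =
λ_n and H = Gᶜ, s = -1 - λ₂ produce all four inequalities.

For equality under symmetry, let w be an `s`-eigenvector and sum w wᵀ over the automorphism group.
If `H` is edge-transitive, the sum is constant and negative on edges; shifting it by a multiple of J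
gives an optimal `B` for `H`. If `H` is also vertex-transitive, rescaling it gives an optimal `N`
for `Hᶜ`. For strongly regular graphs the two restricted eigenvalues are roots of one quadratic, and
Vieta's formulas make the lower and upper bounds equal. -/

/-! ### Semidefinite bounds on the theta function -/

open Matrix in
/-- A positive semidefinite real matrix is a Gram matrix. -/
theorem Matrix.PosSemidef.exists_eq_inner {V : Type*} [Fintype V] [DecidableEq V]
    {N : Matrix V V ℝ} (hN : N.PosSemidef) :
    ∃ x : V → EuclideanSpace ℝ V, ∀ i j, N i j = inner ℝ (x i) (x j) := by
  open scoped MatrixOrder in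
  obtain ⟨B, rfl⟩ := CStarAlgebra.nonneg_iff_eq_star_mul_self.mp hN.nonneg
  refine ⟨fun i => WithLp.toLp 2 fun k => B k i, fun i j => ?_⟩
  simp [Matrix.mul_apply, PiLp.inner_apply, Matrix.star_apply, mul_comm]

open Matrix in
theorem Matrix.PosSemidef.sum_mul_inner_nonneg {V : Type*} [Fintype V]
    {B : Matrix V V ℝ} (hB : B.PosSemidef) {m : ℕ} (x : V → EuclideanSpace ℝ (Fin m)) :
    0 ≤ ∑ i, ∑ j, B i j * inner ℝ (x i) (x j) := by
  have h : ∑ i, ∑ j, B i j * inner ℝ (x i) (x j) =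
      ∑ k, (fun i => x i k) ⬝ᵥ (B *ᵥ fun i => x i k) := by
    simp only [PiLp.inner_apply, dotProduct, mulVec, Finset.mul_sum]
    rw [Finset.sum_comm (s := (Finset.univ : Finset (Fin m)))]
    refine Finset.sum_congr rfl fun i _ => ?_
    rw [Finset.sum_comm (s := (Finset.univ : Finset (Fin m)))]
    refine Finset.sum_congr rfl fun j _ =>
      Finset.sum_congr rfl fun k _ => ?_
    simp
    ring
  rw [h]
  exact Finset.sum_nonneg fun k _ => by
    simpa using hB.dotProduct_mulVec_nonneg fun i => x i k

theorem bddBelow_lovaszThetaValues {V : Type*} (G : SimpleGraph V) :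
    BddBelow (lovaszThetaValues G) := by
  refine ⟨0, ?_⟩
  rintro t ⟨m, u, c, -, -, -, rfl⟩
  exact Real.iSup_nonneg fun i => by positivity

/-- An orthonormal representation in an arbitrary Euclidean space, all of whose vectors have
the same inner product `1 / √t` with the handle, gives the value `t`. -/
theorem mem_lovaszThetaValues {V E : Type*} [Nonempty V] [NormedAddCommGroup E]
    [InnerProductSpace ℝ E] [FiniteDimensional ℝ E] {G : SimpleGraph V} {u : V → E} {c : E} {t : ℝ}
    (ht : 0 < t) (hu : ∀ i, ‖u i‖ = 1)
    (hadj : ∀ i j, i ≠ j → ¬ G.Adj i j → inner ℝ (u i) (u j) = 0) (hc : ‖c‖ = 1)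
    (hcu : ∀ i, inner ℝ c (u i) = 1 / √t) : t ∈ lovaszThetaValues G := by
  let b := (stdOrthonormalBasis ℝ E).repr
  refine ⟨_, fun i => b (u i), b c, ⟨fun i => by simp [hu], fun i j hij h => ?_⟩,
    by simp [hc], fun i => ?_, ?_⟩
  · rw [b.inner_map_map, hadj i j hij h]
  · rw [b.inner_map_map, hcu]
    positivity
  · simp_rw [b.inner_map_map, hcu]
    simp [Real.sq_sqrt ht.le]

/-- If `x` has Gram matrix `N`, the vectors (1, x i) have Gram matrix J + N: squared norm `t`,
orthogonal at non-adjacent pairs, inner product 1 with the handle (1, 0). Scaling by `1 / √t` makes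
them an orthonormal representation. -/
theorem mem_lovaszThetaValues_of_posSemidef {V : Type*} [Fintype V] [DecidableEq V] [Nonempty V]
    {G : SimpleGraph V} {N : Matrix V V ℝ} (hN : N.PosSemidef) {t : ℝ}
    (hdiag : ∀ i, N i i = t - 1) (hadj : ∀ i j, i ≠ j → ¬ G.Adj i j → N i j = -1) :
    t ∈ lovaszThetaValues G := by
  obtain ⟨x, hx⟩ := hN.exists_eq_inner
  have ht : 1 ≤ t := by
    have i := Classical.arbitrary V
    have h1 := hdiag i
    rw [hx, real_inner_self_eq_norm_sq] at h1
    nlinarith [sq_nonneg ‖x i‖]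
  have ht0 : 0 < t := by linarith
  let y : V → WithLp 2 (ℝ × EuclideanSpace ℝ V) := fun i => WithLp.toLp 2 (1, x i)
  let c : WithLp 2 (ℝ × EuclideanSpace ℝ V) := WithLp.toLp 2 (1, 0)
  have hyy (i j) : inner ℝ (y i) (y j) = 1 + N i j := by
    simp [y, WithLp.prod_inner_apply, hx]
  have hcy (i) : inner ℝ c (y i) = 1 := by
    simp [y, c, WithLp.prod_inner_apply]
  have hcc : inner ℝ c c = 1 := by
    simp [c]
  refine mem_lovaszThetaValues (u := fun i => (1 / √t) • y i) (c := c) ht0 (fun i => ?_)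
    (fun i j hij h => ?_) ?_ fun i => ?_
  · have : ‖y i‖ = √t := by
      rw [norm_eq_sqrt_real_inner, hyy, hdiag]
      congr 1
      ring
    have hs : √t ≠ 0 := by positivity
    rw [norm_smul, this, Real.norm_of_nonneg (by positivity)]
    field_simp
  · simp [inner_smul_left, inner_smul_right, hyy, hadj i j hij h]
  · rw [norm_eq_sqrt_real_inner, hcc, Real.sqrt_one]
  · simp [inner_smul_right, hcy]

/-- A feasible point of the primal semidefinite program bounds the theta function from above. -/
theorem lovaszTheta_le_of_posSemidef {V : Type*} [Fintype V] [DecidableEq V] [Nonempty V]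
    {G : SimpleGraph V} {N : Matrix V V ℝ} (hN : N.PosSemidef) {t : ℝ}
    (hdiag : ∀ i, N i i = t - 1) (hadj : ∀ i j, i ≠ j → ¬ G.Adj i j → N i j = -1) :
    lovaszTheta G ≤ t :=
  csInf_le (bddBelow_lovaszThetaValues G) (mem_lovaszThetaValues_of_posSemidef hN hdiag hadj)

/-- The Laplacian nI - J of the complete graph is feasible for every graph, with value n. -/
theorem lovaszThetaValues_nonempty {V : Type*} [Fintype V] [Nonempty V] (G : SimpleGraph V) :
    (lovaszThetaValues G).Nonempty := by
  classical
  let N : Matrix V V ℝ := (⊤ : SimpleGraph V).lapMatrix ℝ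
  have hN : N.PosSemidef := SimpleGraph.posSemidef_lapMatrix ℝ _
  refine ⟨(Fintype.card V : ℝ), mem_lovaszThetaValues_of_posSemidef hN (fun i => ?_)
    fun i j hij _ => ?_⟩
  · simp [N, SimpleGraph.lapMatrix, SimpleGraph.degMatrix, Nat.cast_sub Fintype.card_pos]
  · simp [N, SimpleGraph.lapMatrix, SimpleGraph.degMatrix, hij]

/-- A feasible point of the dual semidefinite program bounds the theta function from below. -/
theorem sum_div_trace_le_lovaszTheta {V : Type*} [Fintype V] [DecidableEq V] [Nonempty V]
    {G : SimpleGraph V} {B : Matrix V V ℝ} (hB : B.PosSemidef) (htr : 0 < B.trace)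
    (hadj : ∀ i j, G.Adj i j → B i j = 0) :
    (∑ i, ∑ j, B i j) / B.trace ≤ lovaszTheta G := by
  refine le_csInf (lovaszThetaValues_nonempty G) ?_
  rintro t ⟨m, u, c, hu, hc, hcu, rfl⟩
  set t := ⨆ i, 1 / (inner ℝ c (u i)) ^ 2 with htdef
  have hle (i) : 1 / (inner ℝ c (u i)) ^ 2 ≤ t :=
    le_ciSup (f := fun i => 1 / (inner ℝ c (u i)) ^ 2) (Set.finite_range _).bddAbove i
  have hcc : inner ℝ c c = (1 : ℝ) := by rw [real_inner_self_eq_norm_sq, hc]; norm_num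
  -- Rescaling `u i` to have component 1 along `c` and removing that component leaves vectors whose
  -- Gram matrix is `-1` at non-adjacent pairs and at most `t - 1` on the diagonal; this is paired
  -- with `B`.
  let x : V → EuclideanSpace ℝ (Fin m) := fun i => (inner ℝ c (u i))⁻¹ • u i - c
  have hx (i j) : inner ℝ (x i) (x j) =
      (inner ℝ c (u i))⁻¹ * (inner ℝ c (u j))⁻¹ * inner ℝ (u i) (u j) - 1 := by
    have h1 := hcu i
    have h2 := hcu j
    simp only [x, inner_sub_left, inner_sub_right, real_inner_smul_left, real_inner_smul_right, hcc,
      real_inner_comm c (u i)]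
    field_simp
    ring
  have hterm (i j) : B i j * inner ℝ (x i) (x j) ≤ (if i = j then t * B i i else 0) - B i j := by
    rcases eq_or_ne i j with rfl | hij
    · have h2 : inner ℝ (x i) (x i) ≤ t - 1 := by
        rw [hx, real_inner_self_eq_norm_sq, hu.norm_eq_one]
        have := hle i
        have h3 : (inner ℝ c (u i))⁻¹ * (inner ℝ c (u i))⁻¹ * (1:ℝ) ^ 2 =
          1 / (inner ℝ c (u i)) ^ 2 := by ring
        linarith
      have := mul_le_mul_of_nonneg_left h2 (hB.diag_nonneg (i := i))
      simp only [if_true]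
      linarith
    · by_cases h : G.Adj i j
      · simp [hadj i j h, hij]
      · rw [hx, hu.inner_eq_zero i j hij h]
        simp [hij]
  rw [div_le_iff₀ htr]
  have h0 := hB.sum_mul_inner_nonneg x
  have h1 := Finset.sum_le_sum fun i (_ : i ∈ Finset.univ) =>
    Finset.sum_le_sum fun j (_ : j ∈ Finset.univ) => hterm i j
  simp only [Finset.sum_sub_distrib, Finset.sum_ite_eq, Finset.mem_univ, if_true,
    ← Finset.mul_sum] at h1
  rw [Matrix.trace]
  simp only [Matrix.diag]
  linarith

/-! ### Hoffman–Lovász bounds for regular graphs -/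

open Matrix in
/-- `s` is the least eigenvalue of the adjacency matrix of `H` on the orthogonal complement of
the all-ones vector. -/
structure IsLeastRestrictedEigenvalue {V : Type*} [Fintype V] (H : SimpleGraph V)
    [DecidableRel H.Adj] (s : ℝ) : Prop where
  le : ∀ v : V → ℝ, ∑ i, v i = 0 → s * (v ⬝ᵥ v) ≤ v ⬝ᵥ (H.adjMatrix ℝ *ᵥ v)
  exists_eigenvector : ∃ w : V → ℝ, ∑ i, w i = 0 ∧ w ≠ 0 ∧ H.adjMatrix ℝ *ᵥ w = s • w

section

open Matrix

variable {V : Type*} [Fintype V] {H : SimpleGraph V} [DecidableRel H.Adj]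
  {d : ℕ} {s : ℝ}

theorem dotProduct_adjMatrix_mulVec_symm (H : SimpleGraph V) [DecidableRel H.Adj] (v w : V → ℝ) :
    v ⬝ᵥ (H.adjMatrix ℝ *ᵥ w) = w ⬝ᵥ (H.adjMatrix ℝ *ᵥ v) := by
  rw [dotProduct_mulVec, ← mulVec_transpose, SimpleGraph.transpose_adjMatrix, dotProduct_comm]

theorem adjMatrix_mulVec_one (hd : H.IsRegularOfDegree d) :
    H.adjMatrix ℝ *ᵥ 1 = (d : ℝ) • (1 : V → ℝ) := by
  ext i
  simp [hd.degree_eq i]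

theorem IsLeastRestrictedEigenvalue.le_neg_one [DecidableEq V]
    (h : IsLeastRestrictedEigenvalue H s) (hne : H ≠ ⊥) : s ≤ -1 := by
  obtain ⟨a, b, hab⟩ := SimpleGraph.ne_bot_iff_exists_adj.mp hne
  -- On an edge, this test vector has quadratic form -2 and squared norm 2.
  have h1 := h.le (Pi.single a 1 - Pi.single b 1) (by simp)
  simp [mulVec_sub, dotProduct_sub, sub_dotProduct, SimpleGraph.adjMatrix_apply, hab, hab.symm,
    hab.ne, hab.ne.symm, -SimpleGraph.adjMatrix_mulVec_apply] at h1
  linarith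

/-- Removing the mean of a vector `v` splits its quadratic form. -/
theorem exists_sum_eq_zero_of_regular [Nonempty V] (hd : H.IsRegularOfDegree d) (v : V → ℝ) :
    ∃ w : V → ℝ, ∑ i, w i = 0 ∧ v ⬝ᵥ v = w ⬝ᵥ w + (∑ i, v i) ^ 2 / Fintype.card V ∧
      v ⬝ᵥ (H.adjMatrix ℝ *ᵥ v) =
        w ⬝ᵥ (H.adjMatrix ℝ *ᵥ w) + d * (∑ i, v i) ^ 2 / Fintype.card V := by
  have hn : (Fintype.card V : ℝ) ≠ 0 := by positivity
  set S := ∑ i, v i with hS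
  set a : ℝ := S / Fintype.card V with ha
  have hv1 : v ⬝ᵥ 1 = S := dotProduct_one v
  have h11 : (1 : V → ℝ) ⬝ᵥ 1 = Fintype.card V := by simp
  refine ⟨v - a • 1, ?_, ?_, ?_⟩
  · simp [← hS, ha]
    field_simp
    ring
  · simp only [dotProduct_sub, sub_dotProduct, smul_dotProduct, dotProduct_smul, hv1, h11,
      dotProduct_comm 1 v, smul_eq_mul, ha]
    field_simp
    ring
  · simp only [dotProduct_sub, sub_dotProduct, smul_dotProduct, dotProduct_smul, hv1, h11,
      mulVec_sub, mulVec_smul, adjMatrix_mulVec_one hd, dotProduct_adjMatrix_mulVec_symm H 1 v,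
      smul_eq_mul, ha]
    field_simp
    ring

/-- The all-ones direction has eigenvalue `d ≥ 0 ≥ s`, so the restricted bound extends to every
vector. -/
theorem IsLeastRestrictedEigenvalue.le_of_nonpos [Nonempty V]
    (h : IsLeastRestrictedEigenvalue H s) (hd : H.IsRegularOfDegree d) (hs : s ≤ 0) (v : V → ℝ) :
    s * (v ⬝ᵥ v) ≤ v ⬝ᵥ (H.adjMatrix ℝ *ᵥ v) := by
  obtain ⟨w, hw, h1, h2⟩ := exists_sum_eq_zero_of_regular hd v
  have h3 := h.le w hw
  have h4 : 0 ≤ (∑ i, v i) ^ 2 / Fintype.card V := by positivity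
  have h5 : d * (∑ i, v i) ^ 2 / Fintype.card V = d * ((∑ i, v i) ^ 2 / Fintype.card V) := by ring
  have h6 : (0 : ℝ) ≤ d := by positivity
  rw [h1, h2, h5]
  nlinarith [mul_nonneg h6 h4, mul_nonneg (neg_nonneg.mpr hs) h4]

theorem sum_sum_eq_one_dotProduct (M : Matrix V V ℝ) :
    ∑ i, ∑ j, M i j = 1 ⬝ᵥ (M *ᵥ 1) := by
  simp [dotProduct, mulVec]

theorem of_one_mulVec (v : V → ℝ) :
    (Matrix.of fun _ _ : V => (1 : ℝ)) *ᵥ v = (∑ i, v i) • 1 := by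
  ext i
  simp [mulVec, dotProduct]

theorem posSemidef_of_one : (Matrix.of fun _ _ : V => (1 : ℝ)).PosSemidef := by
  refine .of_dotProduct_mulVec_nonneg (by ext; simp) fun v => ?_
  rw [of_one_mulVec, star_trivial, dotProduct_smul, dotProduct_one, smul_eq_mul]
  exact mul_self_nonneg _

/-- **Hoffman–Lovász bound** for the theta function of a regular graph. -/
theorem lovaszTheta_le_of_isLeastRestrictedEigenvalue [DecidableEq V] [Nonempty V]
    (h : IsLeastRestrictedEigenvalue H s) (hd : H.IsRegularOfDegree d) (hs : s < 0) :
    lovaszTheta H ≤ -(Fintype.card V * s) / (d - s) := by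
  set n : ℝ := (Fintype.card V : ℝ) with hn
  have hn0 : 0 < n := by positivity
  have hds : 0 < d - s := by have : (0 : ℝ) ≤ d := by positivity
                             linarith
  set t := -(n * s) / (d - s) with ht
  set x := n / (d - s) with hx
  have hx0 : 0 < x := by positivity
  -- Since `t = -x * s` and `x * (d - s) = n`, this matrix kills the all-ones vector and acts as x(A
  -- - sI) on its orthogonal complement.
  let N : Matrix V V ℝ := t • 1 - Matrix.of (fun _ _ => (1 : ℝ)) + x • H.adjMatrix ℝ
  have hN : N.PosSemidef := by
    refine .of_dotProduct_mulVec_nonneg ?_ fun v => ?_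
    · ext i j
      simp [N, SimpleGraph.adjMatrix_apply, H.adj_comm, Matrix.one_apply, eq_comm]
    · obtain ⟨w, hw, h1, h2⟩ := exists_sum_eq_zero_of_regular hd v
      have h3 := h.le w hw
      have : star v ⬝ᵥ (N *ᵥ v) = x * (w ⬝ᵥ (H.adjMatrix ℝ *ᵥ w) - s * (w ⬝ᵥ w)) := by
        have h7 : t = - x * s := by rw [ht, hx]; ring
        have h8 : x * (d - s) = n := by rw [hx]; field_simp
        simp only [N, star_trivial, add_mulVec, sub_mulVec, smul_mulVec, one_mulVec, of_one_mulVec,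
          dotProduct_add, dotProduct_sub, dotProduct_smul, smul_eq_mul, h1, h2, ← hn,
          dotProduct_one, h7]
        have h9 : (∑ i, v i) * (∑ i, v i) = x * (d - s) * ((∑ i, v i) ^ 2 / n) := by
          rw [h8]; field_simp
        rw [h9]
        ring
      rw [this]
      exact mul_nonneg hx0.le (by linarith)
  refine lovaszTheta_le_of_posSemidef hN (fun i => ?_) fun i j hij hadj => ?_
  · simp [N]
  · simp [N, hij, SimpleGraph.adjMatrix_apply, hadj]

/-- **Hoffman–Lovász bound** for the theta function of the complement of a regular graph. -/
theorem le_lovaszTheta_compl_of_isLeastRestrictedEigenvalue [DecidableEq V] [Nonempty V]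
    (h : IsLeastRestrictedEigenvalue H s) (hd : H.IsRegularOfDegree d) (hs : s < 0) :
    1 - d / s ≤ lovaszTheta Hᶜ := by
  -- Zero on the edges of `Hᶜ`, with entry sum n(d - s) and trace -ns.
  let B : Matrix V V ℝ := H.adjMatrix ℝ - s • 1
  have hB : B.PosSemidef := by
    refine .of_dotProduct_mulVec_nonneg ?_ fun v => ?_
    · ext i j
      simp [B, SimpleGraph.adjMatrix_apply, H.adj_comm, Matrix.one_apply, eq_comm]
    · have := h.le_of_nonpos hd hs.le v
      simp only [B, star_trivial, sub_mulVec, smul_mulVec, one_mulVec, dotProduct_sub,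
        dotProduct_smul, smul_eq_mul]
      linarith
  have htr : B.trace = -s * Fintype.card V := by
    simp [B, Matrix.trace_sub]
  have hn0 : (0 : ℝ) < Fintype.card V := by positivity
  have h1 := sum_div_trace_le_lovaszTheta (G := Hᶜ) hB (by rw [htr]; nlinarith)
    fun i j hij => by
      rw [SimpleGraph.compl_adj] at hij
      simp [B, hij.1, hij.2, SimpleGraph.adjMatrix_apply]
  refine le_of_eq_of_le ?_ h1
  rw [htr, sum_sum_eq_one_dotProduct]
  simp only [B, sub_mulVec, smul_mulVec, one_mulVec, adjMatrix_mulVec_one hd, dotProduct_sub,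
    dotProduct_smul]
  simp
  have := hs.ne
  field_simp
  ring

end

/-! ### Averaging over the automorphism group -/

section

open Matrix

variable {V : Type*} [Fintype V] {H : SimpleGraph V}

/-- The sum of the translates of the matrix `w wᵀ` under the automorphism group of `H`. -/
noncomputable def automorphismSum (H : SimpleGraph V) (w : V → ℝ) : Matrix V V ℝ :=
  haveI : Finite (H ≃g H) := DFunLike.finite _
  letI := Fintype.ofFinite (H ≃g H)
  ∑ f : H ≃g H, Matrix.vecMulVec (fun i => w (f i)) (fun i => w (f i))

theorem automorphismSum_posSemidef (H : SimpleGraph V) (w : V → ℝ) :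
    (automorphismSum H w).PosSemidef :=
  posSemidef_sum _ fun f _ => by
    simpa using posSemidef_vecMulVec_self_star (fun i => w (f i))

theorem automorphismSum_apply_apply (w : V → ℝ) (g : H ≃g H) (i j : V) :
    automorphismSum H w (g i) (g j) = automorphismSum H w i j := by
  have : Finite (H ≃g H) := DFunLike.finite _
  let := Fintype.ofFinite (H ≃g H)
  simp only [automorphismSum, Matrix.sum_apply, vecMulVec_apply]
  exact Fintype.sum_equiv (Equiv.mulRight g) _ _ fun f => rfl

theorem automorphismSum_comm (w : V → ℝ) (i j : V) :
    automorphismSum H w i j = automorphismSum H w j i := by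
  simp [automorphismSum, Matrix.sum_apply, vecMulVec_apply, mul_comm]

theorem exists_automorphismSum_eq_of_isEdgeTransitive (hH : IsEdgeTransitive H) (w : V → ℝ) :
    ∃ q, ∀ i j, H.Adj i j → automorphismSum H w i j = q := by
  by_cases hne : ∃ a b, H.Adj a b
  · obtain ⟨a, b, hab⟩ := hne
    refine ⟨automorphismSum H w a b, fun i j hij => ?_⟩
    obtain ⟨f, hf⟩ := hH a b i j hab hij
    rcases Sym2.eq_iff.mp hf with ⟨rfl, rfl⟩ | ⟨rfl, rfl⟩
    · exact automorphismSum_apply_apply w f a b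
    -- The automorphism may reverse the edge; symmetry of the matrix absorbs this.
    · rw [automorphismSum_comm, automorphismSum_apply_apply]
  · exact ⟨0, fun i j hij => (hne ⟨i, j, hij⟩).elim⟩

theorem exists_automorphismSum_eq_of_isVertexTransitive (hH : IsVertexTransitive H) (w : V → ℝ) :
    ∃ p, ∀ i, automorphismSum H w i i = p := by
  by_cases hne : Nonempty V
  · obtain ⟨a⟩ := hne
    refine ⟨automorphismSum H w a a, fun i => ?_⟩
    obtain ⟨f, rfl⟩ := hH a i
    exact automorphismSum_apply_apply w f a a
  · exact ⟨0, fun i => (hne ⟨i⟩).elim⟩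

theorem trace_automorphismSum (H : SimpleGraph V) (w : V → ℝ) :
    (automorphismSum H w).trace = Nat.card (H ≃g H) * (w ⬝ᵥ w) := by
  have : Finite (H ≃g H) := DFunLike.finite _
  let := Fintype.ofFinite (H ≃g H)
  have (f : H ≃g H) : ∑ i, w (f i) * w (f i) = w ⬝ᵥ w :=
    Fintype.sum_equiv f.toEquiv _ (fun i => w i * w i) fun i => rfl
  simp only [automorphismSum, trace_sum, trace_vecMulVec, dotProduct] at this ⊢
  simp [this]

theorem sum_automorphismSum (H : SimpleGraph V) {w : V → ℝ} (hw : ∑ i, w i = 0) :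
    ∑ i, ∑ j, automorphismSum H w i j = 0 := by
  have : Finite (H ≃g H) := DFunLike.finite _
  let := Fintype.ofFinite (H ≃g H)
  have (f : H ≃g H) : ∑ i, w (f i) = 0 := (Equiv.sum_comp f.toEquiv w).trans hw
  rw [sum_sum_eq_one_dotProduct, automorphismSum, sum_mulVec, dotProduct_sum]
  refine Finset.sum_eq_zero fun f _ => ?_
  simp [vecMulVec_mulVec, dotProduct_one, this]

theorem natCard_aut_mul_dotProduct_pos (H : SimpleGraph V) {w : V → ℝ} (hw : w ≠ 0) :
    0 < Nat.card (H ≃g H) * (w ⬝ᵥ w) := by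
  have : Finite (H ≃g H) := DFunLike.finite _
  have h1 : 0 < Nat.card (H ≃g H) := Nat.card_pos
  have h2 : 0 < w ⬝ᵥ w := by
    simpa using dotProduct_star_self_pos_iff.mpr hw
  positivity

variable [DecidableRel H.Adj] {d : ℕ} {s : ℝ}

/-- The inner product of the adjacency matrix with an automorphism sum. -/
theorem sum_adjMatrix_mul_automorphismSum (w : V → ℝ) :
    ∑ i, ∑ j, H.adjMatrix ℝ i j * automorphismSum H w i j =
      Nat.card (H ≃g H) * (w ⬝ᵥ (H.adjMatrix ℝ *ᵥ w)) := by
  have : Finite (H ≃g H) := DFunLike.finite _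
  let := Fintype.ofFinite (H ≃g H)
  have (f : H ≃g H) : ∑ i, ∑ j, H.adjMatrix ℝ i j * (w (f i) * w (f j)) =
      w ⬝ᵥ (H.adjMatrix ℝ *ᵥ w) := by
    simp only [dotProduct, mulVec, Finset.mul_sum]
    refine Fintype.sum_equiv f.toEquiv _ _ fun i => Fintype.sum_equiv f.toEquiv _ _ fun j => ?_
    simp only [SimpleGraph.adjMatrix_apply, RelIso.coe_fn_toEquiv, f.map_adj_iff]
    ring
  simp only [automorphismSum, Matrix.sum_apply, vecMulVec_apply, Finset.mul_sum]
  simp_rw [Finset.sum_comm (t := (Finset.univ : Finset (H ≃g H))), this]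
  simp

/-- The sum of the averaged matrix over ordered adjacent pairs is counted twice: nd equal entries
`q`, or the quadratic form of the eigenvector `w` once per automorphism. -/
theorem card_mul_degree_mul_eq {q : ℝ} (hd : H.IsRegularOfDegree d) {w : V → ℝ}
    (hw : H.adjMatrix ℝ *ᵥ w = s • w)
    (hq : ∀ i j, H.Adj i j → automorphismSum H w i j = q) :
    Fintype.card V * d * q = Nat.card (H ≃g H) * (w ⬝ᵥ w) * s := by
  have h1 := sum_adjMatrix_mul_automorphismSum (H := H) w
  have h2 (i j) : H.adjMatrix ℝ i j * automorphismSum H w i j = q * H.adjMatrix ℝ i j := by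
    by_cases h : H.Adj i j <;> simp [SimpleGraph.adjMatrix_apply, h, hq]
  simp_rw [h2, ← Finset.mul_sum] at h1
  rw [sum_sum_eq_one_dotProduct, adjMatrix_mulVec_one hd, hw] at h1
  simp only [dotProduct_smul, smul_eq_mul] at h1
  rw [mul_assoc, mul_assoc, mul_comm _ s, ← h1]
  simp
  ring

theorem le_lovaszTheta_of_isEdgeTransitive [DecidableEq V] [Nonempty V]
    (h : IsLeastRestrictedEigenvalue H s) (hd : H.IsRegularOfDegree d) (hd0 : d ≠ 0) (hs : s < 0)
    (hH : IsEdgeTransitive H) :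
    -(Fintype.card V * s) / (d - s) ≤ lovaszTheta H := by
  obtain ⟨w, hw, hw0, hws⟩ := h.exists_eigenvector
  obtain ⟨q, hq⟩ := exists_automorphismSum_eq_of_isEdgeTransitive hH w
  have hK := natCard_aut_mul_dotProduct_pos H hw0
  have hcount := card_mul_degree_mul_eq hd hws hq
  have htr := trace_automorphismSum H w
  have hsum := sum_automorphismSum H hw
  set K := Nat.card (H ≃g H) * (w ⬝ᵥ w)
  have hn : (0 : ℝ) < Fintype.card V := by positivity
  have hd' : (0 : ℝ) < d := by positivity
  have hqK : q = K * s / (Fintype.card V * d) := by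
    rw [← hcount]; field_simp
  have hq0 : q < 0 := by
    rw [hqK]
    exact div_neg_of_neg_of_pos (mul_neg_of_pos_of_neg hK hs) (by positivity)
  -- The shift cancels the constant `q` on edges and preserves positivity because `q < 0`. The
  -- averaged part has entry sum 0, so only the shift contributes to the numerator.
  let B := automorphismSum H w + (-q) • Matrix.of fun _ _ : V => (1 : ℝ)
  have hB : B.PosSemidef :=
    (automorphismSum_posSemidef H w).add (posSemidef_of_one.smul (by linarith))
  have hBtr : B.trace = K + (-q) * Fintype.card V := by
    rw [trace_add, htr]
    simp [Matrix.trace]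
    ring
  have hBsum : ∑ i, ∑ j, B i j = (-q) * (Fintype.card V * Fintype.card V) := by
    simp only [B, Matrix.add_apply, Finset.sum_add_distrib, hsum]
    simp
    ring
  have h1 := sum_div_trace_le_lovaszTheta (G := H) hB (by rw [hBtr]; nlinarith)
    fun i j hij => by simp [B, hq i j hij]
  refine le_of_eq_of_le ?_ h1
  have hds : (d : ℝ) - s ≠ 0 := by linarith
  have hden : K + -q * Fintype.card V = K * (d - s) / d := by
    rw [hqK]; field_simp; ring
  rw [hBtr, hBsum, hden, hqK]
  field_simp

theorem lovaszTheta_compl_le_of_isVertexTransitive_of_isEdgeTransitive [DecidableEq V] [Nonempty V]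
    (h : IsLeastRestrictedEigenvalue H s) (hd : H.IsRegularOfDegree d) (hd0 : d ≠ 0) (hs : s < 0)
    (hV : IsVertexTransitive H) (hE : IsEdgeTransitive H) :
    lovaszTheta Hᶜ ≤ 1 - d / s := by
  obtain ⟨w, hw, hw0, hws⟩ := h.exists_eigenvector
  obtain ⟨q, hq⟩ := exists_automorphismSum_eq_of_isEdgeTransitive hE w
  obtain ⟨p, hp⟩ := exists_automorphismSum_eq_of_isVertexTransitive hV w
  have hK := natCard_aut_mul_dotProduct_pos H hw0
  have hcount := card_mul_degree_mul_eq hd hws hq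
  have htr := trace_automorphismSum H w
  set K := Nat.card (H ≃g H) * (w ⬝ᵥ w)
  have hn : (0 : ℝ) < Fintype.card V := by positivity
  have hd' : (0 : ℝ) < d := by positivity
  have hpK : p = K / Fintype.card V := by
    rw [← htr]
    simp [Matrix.trace, hp]
  have hqK : q = K * s / (Fintype.card V * d) := by
    rw [← hcount]; field_simp
  have hq0 : q < 0 := by
    rw [hqK]
    exact div_neg_of_neg_of_pos (mul_neg_of_pos_of_neg hK hs) (by positivity)
  -- This scaling puts `-1` on the edges of `H`, the non-adjacent pairs of `Hᶜ`, and makes the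
  -- diagonal `-p / q = -d / s`.
  have hN : ((-q⁻¹) • automorphismSum H w).PosSemidef :=
    (automorphismSum_posSemidef H w).smul (by simpa using hq0.le)
  refine lovaszTheta_le_of_posSemidef hN (fun i => ?_) fun i j hij hadj => ?_
  · have := hs.ne
    rw [Matrix.smul_apply, hp, hpK, hqK, smul_eq_mul]
    field_simp
    ring
  · have hadj' : H.Adj i j := by
      simpa [SimpleGraph.compl_adj, hij] using hadj
    rw [Matrix.smul_apply, hq i j hadj', smul_eq_mul, neg_mul, inv_mul_cancel₀ hq0.ne]

end

/-! ### Extreme eigenvalues of a regular graph on the complement of the all-ones vector -/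

section

open Matrix

variable {V : Type*} [Fintype V] {G : SimpleGraph V} [DecidableRel G.Adj] {d : ℕ}

theorem eigenvector_dotProduct_mulVec {b : V → ℝ} {c : ℝ} (hb : G.adjMatrix ℝ *ᵥ b = c • b)
    (v : V → ℝ) : b ⬝ᵥ (G.adjMatrix ℝ *ᵥ v) = c * (b ⬝ᵥ v) := by
  rw [dotProduct_adjMatrix_mulVec_symm, hb, dotProduct_smul, dotProduct_comm, smul_eq_mul]

theorem ne_zero_of_dotProduct_self_eq_one {w : V → ℝ} (h : w ⬝ᵥ w = 1) : w ≠ 0 := by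
  rintro rfl
  simp at h

theorem sum_eq_zero_of_eigenvector (hd : G.IsRegularOfDegree d) {b : V → ℝ} {c : ℝ}
    (hb : G.adjMatrix ℝ *ᵥ b = c • b) (hc : c ≠ d) : ∑ i, b i = 0 := by
  have h := eigenvector_dotProduct_mulVec hb 1
  rw [adjMatrix_mulVec_one hd, dotProduct_smul, dotProduct_one, smul_eq_mul] at h
  have : (c - d) * ∑ i, b i = 0 := by linarith
  exact (mul_eq_zero.mp this).resolve_left (sub_ne_zero.mpr hc)

variable [DecidableEq V]

theorem graphEigenvalue_add_one (G : SimpleGraph V) [DecidableRel G.Adj]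
    (k : Fin (Fintype.card V)) :
    graphEigenvalue G (k + 1) = (G.isHermitian_adjMatrix ℝ).eigenvalues₀ k := by
  rw [graphEigenvalue, dif_pos ⟨by omega, by omega⟩]
  rfl

theorem graphEigenvalue_anti (G : SimpleGraph V) [DecidableRel G.Adj]
    {k l : Fin (Fintype.card V)} (h : k ≤ l) :
    graphEigenvalue G (l + 1) ≤ graphEigenvalue G (k + 1) := by
  rw [graphEigenvalue_add_one, graphEigenvalue_add_one]
  exact (G.isHermitian_adjMatrix ℝ).eigenvalues₀_antitone h

/-- An orthonormal basis of eigenvectors, ordered as the eigenvalues. -/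
theorem exists_eigenbasis (G : SimpleGraph V) [DecidableRel G.Adj] :
    ∃ b : Fin (Fintype.card V) → V → ℝ,
      (∀ k, G.adjMatrix ℝ *ᵥ b k = graphEigenvalue G (k + 1) • b k) ∧
      (∀ k l, b k ⬝ᵥ b l = if k = l then 1 else 0) ∧
      ∀ v w : V → ℝ, v ⬝ᵥ w = ∑ k, (v ⬝ᵥ b k) * (b k ⬝ᵥ w) := by
  let hA := G.isHermitian_adjMatrix ℝ
  let e : Fin (Fintype.card V) ≃ V := Fintype.equivOfCardEq (Fintype.card_fin _)
  have hin (x y : EuclideanSpace ℝ V) : inner ℝ x y = x.ofLp ⬝ᵥ y.ofLp := by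
    simp [PiLp.inner_apply, dotProduct, mul_comm]
  refine ⟨fun k => hA.eigenvectorBasis (e k), fun k => ?_, fun k l => ?_, fun v w => ?_⟩
  · rw [graphEigenvalue_add_one, hA.mulVec_eigenvectorBasis, IsHermitian.eigenvalues]
    simp [e]
  · rw [← hin, orthonormal_iff_ite.mp hA.eigenvectorBasis.orthonormal]
    simp
  · have h := hA.eigenvectorBasis.sum_inner_mul_inner (WithLp.toLp 2 v) (WithLp.toLp 2 w)
    simp only [hin] at h
    rw [← h]
    exact (e.sum_comp fun i => _).symm

theorem dotProduct_mulVec_le_degree_mul (hd : G.IsRegularOfDegree d) (v : V → ℝ) :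
    v ⬝ᵥ (G.adjMatrix ℝ *ᵥ v) ≤ d * (v ⬝ᵥ v) := by
  have h := (SimpleGraph.posSemidef_lapMatrix ℝ G).dotProduct_mulVec_nonneg v
  have h2 : G.degMatrix ℝ = (d : ℝ) • 1 := by
    ext i j
    simp [SimpleGraph.degMatrix, hd.degree_eq, Matrix.diagonal_apply, Matrix.one_apply]
  simp only [SimpleGraph.lapMatrix, h2, star_trivial, sub_mulVec, dotProduct_sub, smul_mulVec,
    one_mulVec, dotProduct_smul, smul_eq_mul] at h
  linarith

theorem isLeastRestrictedEigenvalue_graphEigenvalue_card (hd : G.IsRegularOfDegree d)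
    (hne : G ≠ ⊥) : IsLeastRestrictedEigenvalue G (graphEigenvalue G (Fintype.card V)) := by
  obtain ⟨a, a', haa⟩ := SimpleGraph.ne_bot_iff_exists_adj.mp hne
  have hcard : 0 < Fintype.card V := Fintype.card_pos_iff.mpr ⟨a⟩
  obtain ⟨b, hb, horth, hsum⟩ := exists_eigenbasis G
  let l : Fin (Fintype.card V) := ⟨Fintype.card V - 1, by omega⟩
  have hl : (l : ℕ) + 1 = Fintype.card V := by simp [l]; omega
  set s := graphEigenvalue G (Fintype.card V) with hs
  have hsl : s = graphEigenvalue G (l + 1) := by rw [hs, hl]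
  have hle (v : V → ℝ) : s * (v ⬝ᵥ v) ≤ v ⬝ᵥ (G.adjMatrix ℝ *ᵥ v) := by
    rw [hsum v v, hsum v (G.adjMatrix ℝ *ᵥ v), Finset.mul_sum]
    refine Finset.sum_le_sum fun k _ => ?_
    rw [eigenvector_dotProduct_mulVec (hb k), dotProduct_comm (b k) v]
    have h1 : s ≤ graphEigenvalue G (k + 1) := by
      rw [hsl]
      exact graphEigenvalue_anti G (by simp only [Fin.le_def, l]; omega)
    nlinarith [mul_self_nonneg (v ⬝ᵥ b k)]
  have hs0 : s < 0 := by
    have h1 := hle (Pi.single a 1 - Pi.single a' 1)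
    simp [mulVec_sub, dotProduct_sub, sub_dotProduct, SimpleGraph.adjMatrix_apply, haa, haa.symm,
      haa.ne, haa.ne.symm, -SimpleGraph.adjMatrix_mulVec_apply] at h1
    linarith
  have hbl := hb l
  rw [← hsl] at hbl
  -- As `s < 0 ≤ d`, an `s`-eigenvector is orthogonal to the all-ones vector.
  refine ⟨fun v _ => hle v, b l, sum_eq_zero_of_eigenvector hd hbl ?_,
    ne_zero_of_dotProduct_self_eq_one (by simp [horth]), hbl⟩
  have : (0 : ℝ) ≤ d := by positivity
  linarith

/-- The second largest eigenvalue of a regular graph is the largest one on the orthogonal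
complement of the all-ones vector. -/
theorem graphEigenvalue_two_spec (hd : G.IsRegularOfDegree d) (hcard : 2 ≤ Fintype.card V) :
    (∀ v : V → ℝ, ∑ i, v i = 0 →
      v ⬝ᵥ (G.adjMatrix ℝ *ᵥ v) ≤ graphEigenvalue G 2 * (v ⬝ᵥ v)) ∧
    ∃ w : V → ℝ, ∑ i, w i = 0 ∧ w ≠ 0 ∧ G.adjMatrix ℝ *ᵥ w = graphEigenvalue G 2 • w := by
  obtain ⟨b, hb, horth, hsum⟩ := exists_eigenbasis G
  let k₀ : Fin (Fintype.card V) := ⟨0, by omega⟩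
  let k₁ : Fin (Fintype.card V) := ⟨1, by omega⟩
  have hk : k₀ ≠ k₁ := by simp [k₀, k₁]
  have hb₀ : G.adjMatrix ℝ *ᵥ b k₀ = graphEigenvalue G 1 • b k₀ := hb k₀
  have hb₁ : G.adjMatrix ℝ *ᵥ b k₁ = graphEigenvalue G 2 • b k₁ := hb k₁
  have hle (k) (h : k ≠ k₀) : graphEigenvalue G (k + 1) ≤ graphEigenvalue G 2 :=
    graphEigenvalue_anti G (k := k₁) (l := k) (by
      simp only [ne_eq, Fin.ext_iff, k₀, Fin.le_def, k₁] at h ⊢; omega)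
  set r := graphEigenvalue G 2 with hr
  -- If `d ≤ r`, the top two eigenvalues both equal `d`, and some combination of `b k₀` and `b k₁`
  -- has sum zero. Otherwise every `b k` with `k ≠ k₀` has sum zero, so the all-ones vector is a
  -- multiple of `b k₀`.
  by_cases hrd : (d : ℝ) ≤ r
  · refine ⟨fun v _ => (dotProduct_mulVec_le_degree_mul hd v).trans ?_, ?_⟩
    · exact mul_le_mul_of_nonneg_right hrd (by simpa using dotProduct_star_self_nonneg v)
    · have h1 : graphEigenvalue G 1 ≤ d := by
        have := dotProduct_mulVec_le_degree_mul hd (b k₀)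
        rw [hb₀, dotProduct_smul, horth] at this
        simpa using this
      have h2 : r ≤ graphEigenvalue G 1 :=
        graphEigenvalue_anti G (k := k₀) (l := k₁) (by simp [k₀, k₁, Fin.le_def])
      rw [le_antisymm (h1.trans hrd) h2] at hb₀
      by_cases h : ∑ i, b k₁ i = 0
      · exact ⟨b k₁, h, ne_zero_of_dotProduct_self_eq_one (by simp [horth]), hb₁⟩
      · refine ⟨b k₀ - ((∑ i, b k₀ i) / ∑ i, b k₁ i) • b k₁, ?_, fun h0 => ?_, ?_⟩
        · simp [← Finset.mul_sum]
          field_simp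
          ring
        · have := congrArg (fun w => b k₀ ⬝ᵥ w) h0
          simp [dotProduct_sub, horth, hk] at this
        · rw [mulVec_sub, mulVec_smul, hb₀, hb₁, smul_sub, smul_comm r]
  · rw [not_le] at hrd
    have hzero (k) (h : k ≠ k₀) : ∑ i, b k i = 0 :=
      sum_eq_zero_of_eigenvector hd (hb k) ((hle k h).trans_lt hrd).ne
    have hone (v : V → ℝ) : ∑ i, v i = (v ⬝ᵥ b k₀) * ∑ i, b k₀ i := by
      rw [← dotProduct_one, hsum v 1, Finset.sum_eq_single k₀, dotProduct_one]
      · intro k _ h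
        rw [dotProduct_one, hzero k h, mul_zero]
      · simp
    refine ⟨fun v hv => ?_, b k₁, hzero k₁ hk.symm,
      ne_zero_of_dotProduct_self_eq_one (by simp [horth]), hb₁⟩
    have hb0 : ∑ i, b k₀ i ≠ 0 := by
      intro h
      have := hone 1
      rw [h, mul_zero] at this
      simp at this
      omega
    have hv0 : v ⬝ᵥ b k₀ = 0 := by
      have := hone v
      rw [hv] at this
      exact (mul_eq_zero.mp this.symm).resolve_right hb0
    rw [hsum v v, hsum v (G.adjMatrix ℝ *ᵥ v), Finset.mul_sum]
    refine Finset.sum_le_sum fun k _ => ?_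
    rw [eigenvector_dotProduct_mulVec (hb k), dotProduct_comm (b k) v]
    by_cases h : k = k₀
    · simp [h, hv0]
    · nlinarith [mul_self_nonneg (v ⬝ᵥ b k), hle k h]

/-! ### Passage to the complement -/

theorem adjMatrix_compl_eq {W : Type*} [DecidableEq W] (G : SimpleGraph W) [DecidableRel G.Adj] :
    Gᶜ.adjMatrix ℝ = Matrix.of (fun _ _ => (1 : ℝ)) - 1 - G.adjMatrix ℝ := by
  ext i j
  by_cases hij : i = j
  · simp [hij]
  · by_cases h : G.Adj i j <;> simp [SimpleGraph.adjMatrix_apply, hij, h]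

theorem adjMatrix_compl_mulVec {v : V → ℝ} (hv : ∑ i, v i = 0) :
    Gᶜ.adjMatrix ℝ *ᵥ v = -v - G.adjMatrix ℝ *ᵥ v := by
  rw [adjMatrix_compl_eq, sub_mulVec, sub_mulVec, of_one_mulVec, hv, one_mulVec]
  simp

/-- On vectors of sum zero J vanishes, so the complement acts as -I - A and the largest restricted
eigenvalue becomes the least. -/
theorem isLeastRestrictedEigenvalue_compl (hd : G.IsRegularOfDegree d)
    (hcard : 2 ≤ Fintype.card V) :
    IsLeastRestrictedEigenvalue Gᶜ (-1 - graphEigenvalue G 2) := by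
  obtain ⟨hle, w, hw, hw0, hww⟩ := graphEigenvalue_two_spec hd hcard
  refine ⟨fun v hv => ?_, w, hw, hw0, ?_⟩
  · have := hle v hv
    rw [adjMatrix_compl_mulVec hv, dotProduct_sub, dotProduct_neg]
    linarith
  · rw [adjMatrix_compl_mulVec hw, hww, sub_smul, neg_smul, one_smul]

/-! ### Strongly regular graphs -/

/-- A restricted eigenvalue of a strongly regular graph is a root of a quadratic polynomial. -/
theorem SimpleGraph.IsSRGWith.sq_eq_of_eigenvector {n l m : ℕ} (h : G.IsSRGWith n d l m)
    {w : V → ℝ} {c : ℝ} (hw : ∑ i, w i = 0) (hw0 : w ≠ 0) (hc : G.adjMatrix ℝ *ᵥ w = c • w) :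
    c ^ 2 = d + l * c + m * (-1 - c) := by
  have h1 := congrArg (fun M => M *ᵥ w) (h.matrix_eq (α := ℝ))
  simp only [sq, ← mulVec_mulVec, hc, mulVec_smul, add_mulVec, smul_mulVec, one_mulVec,
    adjMatrix_compl_mulVec hw] at h1
  obtain ⟨i, hi⟩ := Function.ne_iff.mp hw0
  have h2 := congrFun h1 i
  simp at h2
  have hi' : w i ≠ 0 := hi
  apply mul_right_cancel₀ hi'
  linarith

/-- The matrix identity A² = dI + lA + mĀ, with Ā the adjacency matrix of the complement, applied to
the all-ones vector. -/
theorem SimpleGraph.IsSRGWith.degree_sq_eq [Nonempty V] {n l m : ℕ} (h : G.IsSRGWith n d l m) :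
    (d : ℝ) ^ 2 = d + l * d + m * (n - 1 - d) := by
  have h1 := congrArg (fun M => M *ᵥ (1 : V → ℝ)) (h.matrix_eq (α := ℝ))
  simp only [sq, ← mulVec_mulVec, adjMatrix_mulVec_one h.regular, mulVec_smul, add_mulVec,
    smul_mulVec, one_mulVec, adjMatrix_compl_eq, sub_mulVec, of_one_mulVec] at h1
  have h2 := congrFun h1 (Classical.arbitrary V)
  simp [h.card] at h2
  linarith

/-- For strongly regular graphs the two bounds on the theta function coincide. -/
theorem SimpleGraph.IsSRGWith.bounds_eq [Nonempty V] {n l m : ℕ} {r s : ℝ}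
    (h : G.IsSRGWith n d l m) (hr : ∃ w : V → ℝ, ∑ i, w i = 0 ∧ w ≠ 0 ∧
      G.adjMatrix ℝ *ᵥ w = r • w) (hs : ∃ w : V → ℝ, ∑ i, w i = 0 ∧ w ≠ 0 ∧
      G.adjMatrix ℝ *ᵥ w = s • w) (hr0 : 0 ≤ r) (hs0 : s < 0) :
    (n - d + r) / (1 + r) = -(n * s) / (d - s) := by
  obtain ⟨w, hw, hw0, hwr⟩ := hr
  obtain ⟨w', hw', hw0', hws⟩ := hs
  have h1 := h.sq_eq_of_eigenvector hw hw0 hwr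
  have h2 := h.sq_eq_of_eigenvector hw' hw0' hws
  have h3 := h.degree_sq_eq
  have hd : (0 : ℝ) ≤ d := by positivity
  -- Vieta: `r` and `s` are distinct roots of the same monic quadratic. After cross-multiplication
  -- only `r + s` and `r * s` remain, and the degree identity closes the goal.
  have hsum : r + s = l - m := by
    have : (r - s) * (r + s - (l - m)) = 0 := by linarith
    have := (mul_eq_zero.mp this).resolve_left (by linarith)
    linarith
  have hprod : r * s = m - d := by
    have : r * (r + s) = r * (l - m) := by rw [hsum]
    linarith
  rw [div_eq_div_iff (by linarith) (by linarith)]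
  linear_combination (d : ℝ) * hsum + (n - 1) * hprod - h3

end

/-! ### Assembly of the bounds and equality cases -/

theorem proposition1 {V : Type*} [Fintype V] [DecidableEq V]
    (G : SimpleGraph V) [DecidableRel G.Adj] (n d : ℕ)
    (hn : Fintype.card V = n) (hd : G.IsRegularOfDegree d)
    (hcomplete : G ≠ ⊤) (hempty : G ≠ ⊥) :
    -- bounds on the theta function of `G`
    (((n - d + graphEigenvalue G 2) / (1 + graphEigenvalue G 2) ≤ lovaszTheta G ∧
        lovaszTheta G ≤ -(n * graphEigenvalue G n) / (d - graphEigenvalue G n)) ∧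
      -- equality in the left inequality
      ((IsVertexTransitive Gᶜ ∧ IsEdgeTransitive Gᶜ) ∨ (∃ l m : ℕ, G.IsSRGWith n d l m) →
        (n - d + graphEigenvalue G 2) / (1 + graphEigenvalue G 2) = lovaszTheta G) ∧
      -- equality in the right inequality
      (IsEdgeTransitive G ∨ (∃ l m : ℕ, G.IsSRGWith n d l m) →
        lovaszTheta G = -(n * graphEigenvalue G n) / (d - graphEigenvalue G n))) ∧
    -- bounds on the theta function of the complement of `G`
    ((1 - d / graphEigenvalue G n ≤ lovaszTheta Gᶜ ∧
        lovaszTheta Gᶜ ≤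
          n * (1 + graphEigenvalue G 2) / (n - d + graphEigenvalue G 2)) ∧
      -- equality in the left inequality
      ((IsVertexTransitive G ∧ IsEdgeTransitive G) ∨ (∃ l m : ℕ, G.IsSRGWith n d l m) →
        1 - d / graphEigenvalue G n = lovaszTheta Gᶜ) ∧
      -- equality in the right inequality
      (IsEdgeTransitive Gᶜ ∨ (∃ l m : ℕ, G.IsSRGWith n d l m) →
        lovaszTheta Gᶜ =
          n * (1 + graphEigenvalue G 2) / (n - d + graphEigenvalue G 2))) := by
  subst hn
  have hGc : Gᶜ ≠ ⊥ := by simpa using hcomplete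
  obtain ⟨a, b, hab⟩ := SimpleGraph.ne_bot_iff_exists_adj.mp hempty
  have : Nonempty V := ⟨a⟩
  have hcard : 2 ≤ Fintype.card V := Fintype.one_lt_card_iff.mpr ⟨a, b, hab.ne⟩
  have hdn : d + 1 ≤ Fintype.card V := by
    rw [← hd.degree_eq a]
    exact G.degree_lt_card_verts a
  have hd0 : d ≠ 0 := by
    rw [← hd.degree_eq a]
    exact (G.degree_pos_iff_exists_adj _ |>.mpr ⟨b, hab⟩).ne'
  have hdc := hd.compl
  obtain ⟨a', b', hab'⟩ := SimpleGraph.ne_bot_iff_exists_adj.mp hGc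
  have hdc0 : Fintype.card V - 1 - d ≠ 0 := by
    rw [← hdc.degree_eq a']
    exact (Gᶜ.degree_pos_iff_exists_adj _ |>.mpr ⟨b', hab'⟩).ne'
  have hdcast : ((Fintype.card V - 1 - d : ℕ) : ℝ) = Fintype.card V - 1 - d := by
    rw [Nat.cast_sub (by omega), Nat.cast_sub (by omega), Nat.cast_one]
  have hs := isLeastRestrictedEigenvalue_graphEigenvalue_card hd hempty
  have hr := isLeastRestrictedEigenvalue_compl hd hcard
  obtain ⟨-, hrw⟩ := graphEigenvalue_two_spec hd hcard
  -- These give `s ≤ -1` and `r ≥ 0`, hence the signs of all denominators.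
  have hs1 := hs.le_neg_one hempty
  have hr1 := hr.le_neg_one hGc
  set r := graphEigenvalue G 2
  set s := graphEigenvalue G (Fintype.card V)
  have hs0 : s < 0 := by linarith
  have hr0 : -1 - r < 0 := by linarith
  have hdnR : (d : ℝ) + 1 ≤ Fintype.card V := by exact_mod_cast hdn
  have hdR : (0 : ℝ) ≤ d := by positivity
  have hnR : (0 : ℝ) < Fintype.card V := by positivity
  set n : ℝ := (Fintype.card V : ℝ)
  -- The bounds for `Gᶜ` come from replacing (d, s) by (n - 1 - d, -1 - r); `hlow` and `hupp`
  -- rewrite them in terms of `G`.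
  have hlow : 1 - ((Fintype.card V - 1 - d : ℕ) : ℝ) / (-1 - r) = (n - d + r) / (1 + r) := by
    have h1 : 1 + r ≠ 0 := by linarith
    rw [hdcast, show -1 - r = -(1 + r) by ring]
    field_simp
    ring
  have hupp : -(n * (-1 - r)) / (((Fintype.card V - 1 - d : ℕ) : ℝ) - (-1 - r)) =
      n * (1 + r) / (n - d + r) := by
    rw [hdcast]
    congr 1 <;> ring
  have lower := le_lovaszTheta_compl_of_isLeastRestrictedEigenvalue hr hdc hr0
  have upper := lovaszTheta_le_of_isLeastRestrictedEigenvalue hs hd hs0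
  have lower' := le_lovaszTheta_compl_of_isLeastRestrictedEigenvalue hs hd hs0
  have upper' := lovaszTheta_le_of_isLeastRestrictedEigenvalue hr hdc hr0
  rw [hlow, compl_compl] at lower
  rw [hupp] at upper'
  have srg (h : ∃ l m : ℕ, G.IsSRGWith (Fintype.card V) d l m) :
      (n - d + r) / (1 + r) = -(n * s) / (d - s) := by
    obtain ⟨l, m, h⟩ := h
    exact h.bounds_eq hrw hs.exists_eigenvector (by linarith) hs0
  have srg' (h : ∃ l m : ℕ, G.IsSRGWith (Fintype.card V) d l m) :
      1 - d / s = n * (1 + r) / (n - d + r) := by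
    -- The lower bound for `G` times the upper bound for `Gᶜ` is n, and likewise with lower and
    -- upper exchanged; so this case reduces to `srg`.
    have h1 : n * (1 + r) / (n - d + r) = n / ((n - d + r) / (1 + r)) := by rw [div_div_eq_mul_div]
    rw [h1, srg h]
    have h2 : (d : ℝ) - s ≠ 0 := by linarith
    have h3 := hs0.ne
    field_simp
    ring
  refine ⟨⟨⟨lower, upper⟩, ?_, ?_⟩, ⟨lower', upper'⟩, ?_, ?_⟩
  · rintro (⟨hV, hE⟩ | h)
    · have := lovaszTheta_compl_le_of_isVertexTransitive_of_isEdgeTransitive hr hdc hdc0 hr0 hV hE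
      rw [hlow, compl_compl] at this
      exact le_antisymm lower this
    · exact le_antisymm lower (upper.trans_eq (srg h).symm)
  · rintro (hE | h)
    · exact le_antisymm upper (le_lovaszTheta_of_isEdgeTransitive hs hd hd0 hs0 hE)
    · exact le_antisymm upper ((srg h).symm.trans_le lower)
  · rintro (⟨hV, hE⟩ | h)
    · exact le_antisymm lower'
        (lovaszTheta_compl_le_of_isVertexTransitive_of_isEdgeTransitive hs hd hd0 hs0 hV hE)
    · exact le_antisymm lower' (upper'.trans_eq (srg' h).symm)
  · rintro (hE | h)
    · have := le_lovaszTheta_of_isEdgeTransitive hr hdc hdc0 hr0 hE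
      rw [hupp] at this
      exact le_antisymm upper' this
    · exact le_antisymm upper' ((srg' h).symm.trans_le lower')
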